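/- Let $\mathrm{Sym}_{n,\mathbb C}$ be the space of complex symmetric $n\times n$ matrices with the spectral norm $\|\cdot\|_2$ (largest singular value), and let $\mathbb{SD}_n=\{x\in \mathrm{Sym}_{n,\mathbb C}: I-xx^H \text{ is positive definite}\}=\{x\in \mathrm{Sym}_{n,\mathbb C}:\|x\|_2<1\}$ be the Siegel disk. For $x\in\mathbb{SD}_n$ let $\phi_x:\mathbb{SD}_n\to\mathbb{SD}_n$ be the bijection $$\phi_x(y)=(I-xx^H)^{-1/2}(y-x)(I-x^Hy)^{-1}(I-x^Hx)^{1/2},$$ so that $\phi_x(x)=0$, and put $s\otimes w=\phi_0^{-1}(s\,\phi_0(w))$ for $s\in[0,1]$, $w\in\mathbb{SD}_n$. Let $d^K$ be the Kobayashi pseudodistance of the domain $\mathbb{SD}_n\subset \mathrm{Sym}_{n,\mathbb C}$: $d^K(x,y)=\inf_\gamma\int_0^1 g^K(\gamma(t),\gamma'(t))\,dt$ over all piecewise $C^1$ curves $\gamma:[0,1]\to\mathbb{SD}_n$ from $x$ to $y$, where $g^K(x,v)$ is the infimum of $1/\tau$ over all $\tau>0$ for which there is a holomorphic map $h$ from the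 open unit disc of $\mathbb C$ to $\mathbb{SD}_n$ with $h(0)=x$ and $h'(0)=\tau v$. An almost geodesic joining $x,y\in\mathbb{SD}_n$ is a curve $\gamma:[0,1]\to\mathbb{SD}_n$ of the form $\gamma(t)=\phi_x^{-1}(\alpha(t)\otimes\phi_x(y))$, where $\alpha:[0,1]\to[0,1]$ satisfies $$d^K(0,\alpha(t)\otimes\phi_x(y))=t\,d^K(0,\phi_x(y))\qquad\text{for all } t\in[0,1].$$ Let $x,y\in\mathbb{SD}_n$ and $z=\phi_x(y)$. Then there is exactly one almost geodesic $\gamma_{x,y}$ joining $x$ and $y$. It satisfies $\gamma_{x,y}(0)=x$ and $\gamma_{x,y}(1)=y$, and it is given for $t\in[0,1]$ by $$\gamma_{x,y}(t)=\phi_x^{-1}\left(\frac{1}{\|z\|_2}\,\frac{(1+\|z\|_2)^t-(1-\|z\|_2)^t}{(1+\|z\|_2)^t+(1-\|z\|_2)^t}\;z\right),$$ where the argument of $\phi_x^{-1}$ lies in $\mathbb{SD}_n$ and is read as $0$ if $z=0$ (that is, if $x=y$). -/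

import Mathlib

open scoped Matrix MatrixOrder ComplexOrder Matrix.Norms.L2Operator ENNReal

/-! ## The Kobayashi pseudodistance of a domain in a complex normed space -/

/-- The Kobayashi differential metric of a domain `D` at the point `x` in the direction `v`: the
infimum of `1 / τ` over all `τ > 0` for which there is a holomorphic map `h` from the open unit disc
to `D` with `h 0 = x` and `h' 0 = τ v`. -/
noncomputable def kobayashiMetric {E : Type*} [NormedAddCommGroup E] [NormedSpace ℂ E]
    (D : Set E) (x v : E) : ℝ≥0∞ :=
  sInf {r : ℝ≥0∞ | ∃ (τ : ℝ) (h : ℂ → E), 0 < τ ∧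
    AnalyticOnNhd ℂ h (Metric.ball 0 1) ∧ Set.MapsTo h (Metric.ball 0 1) D ∧
    h 0 = x ∧ deriv h 0 = (τ : ℂ) • v ∧ r = ENNReal.ofReal (1 / τ)}

/-- `γ` is a piecewise `C¹` curve on `[0,1]`: it is continuous there, and `C¹` (up to the end points)
on each of the finitely many closed intervals of some partition. -/
def IsPiecewiseC1 {E : Type*} [NormedAddCommGroup E] [NormedSpace ℝ E] (γ : ℝ → E) : Prop :=
  ContinuousOn γ (Set.Icc 0 1) ∧
    ∃ (k : ℕ) (p : ℕ → ℝ), p 0 = 0 ∧ p k = 1 ∧ (∀ i < k, p i < p (i + 1)) ∧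
      ∀ i < k, ContDiffOn ℝ 1 γ (Set.Icc (p i) (p (i + 1)))

/-- The Kobayashi pseudodistance of `D`: the integrated form of the Kobayashi differential metric,
that is, the infimum of the lengths of the piecewise `C¹` curves in `D` from `x` to `y`. -/
noncomputable def kobayashiDist {E : Type*} [NormedAddCommGroup E] [NormedSpace ℂ E]
    (D : Set E) (x y : E) : ℝ≥0∞ :=
  sInf {L : ℝ≥0∞ | ∃ γ : ℝ → E, IsPiecewiseC1 γ ∧ Set.MapsTo γ (Set.Icc 0 1) D ∧
    γ 0 = x ∧ γ 1 = y ∧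
    L = ∫⁻ t in Set.Icc (0 : ℝ) 1, kobayashiMetric D (γ t) (deriv γ t)}

/-! ## Almost geodesics -/

/-- Almost geodesics on a space `M` with automorphisms `φ x`, identity element `o`, scalar
multiplication `t ⊗ x` for `t ∈ [0,1]`, and distance function `d`. The curve `γ : [0,1] → M` is an
almost geodesic joining `x` and `y` if `γ t = (φ x)⁻¹ (α t ⊗ φ x y)` for some `α : [0,1] → [0,1]`
that solves `d (o, α t ⊗ φ x y) = t d (o, φ x y)`. -/
def IsAlmostGeodesic {M : Type*} (φ : M → M ≃ M) (o : M)
    (smul : Set.Icc (0 : ℝ) 1 → M → M) (d : M → M → ℝ≥0∞)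
    (x y : M) (γ : Set.Icc (0 : ℝ) 1 → M) : Prop :=
  ∃ α : Set.Icc (0 : ℝ) 1 → Set.Icc (0 : ℝ) 1,
    (∀ t, d o (smul (α t) (φ x y)) = ENNReal.ofReal (t : ℝ) * d o (φ x y)) ∧
    ∀ t, γ t = (φ x).symm (smul (α t) (φ x y))

/-! ## The Siegel disk -/

/-- The space of complex symmetric `n × n` matrices. The norm on matrices, here and below, is the
spectral norm, i.e. the operator norm for the Euclidean norm on `ℂⁿ` (the largest singular value). -/
def symMatrix (n : ℕ) : Submodule ℂ (Matrix (Fin n) (Fin n) ℂ) where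
  carrier := {x | xᵀ = x}
  add_mem' := by
    intro a b ha hb
    simp only [Set.mem_ofPred_eq] at ha hb ⊢
    rw [Matrix.transpose_add, ha, hb]
  zero_mem' := Matrix.transpose_zero
  smul_mem' := by
    intro c a ha
    simp only [Set.mem_ofPred_eq] at ha ⊢
    rw [Matrix.transpose_smul, ha]

/-- The Siegel disk: the complex symmetric matrices `x` with `I - x xᴴ` positive definite. -/
def siegelDisk (n : ℕ) : Set (symMatrix n) :=
  {x | (1 - (x : Matrix (Fin n) (Fin n) ℂ) * (x : Matrix (Fin n) (Fin n) ℂ)ᴴ).PosDef}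

/-- The matrix `(I - x xᴴ)^(-1/2) (y - x) (I - xᴴ y)⁻¹ (I - xᴴ x)^(1/2)`. -/
noncomputable def siegelFormula {n : ℕ} (x y : Matrix (Fin n) (Fin n) ℂ) :
    Matrix (Fin n) (Fin n) ℂ :=
  (CFC.sqrt (1 - x * xᴴ))⁻¹ * (y - x) * (1 - xᴴ * y)⁻¹ * CFC.sqrt (1 - xᴴ * x)

/-! The facts that make `y ↦ siegelFormula x y` a bijection of the Siegel disk. -/

theorem siegel_posDef_iff {n : ℕ} (x : Matrix (Fin n) (Fin n) ℂ) : (1 - x * xᴴ).PosDef ↔ ‖x‖ < 1 := by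
  have hnn : 0 ≤ x * xᴴ := by
    rw [Matrix.nonneg_iff_posSemidef]; exact Matrix.posSemidef_self_mul_conjTranspose x
  have hnorm : ‖x * xᴴ‖ = ‖x‖ * ‖x‖ := CStarRing.norm_self_mul_star
  constructor
  · intro h
    rcases subsingleton_or_nontrivial (Matrix (Fin n) (Fin n) ℂ) with hs | hs
    · rw [Subsingleton.elim x 0, norm_zero]; exact one_pos
    have h1 : x * xᴴ ≤ 1 := Matrix.le_iff.mpr h.posSemidef
    have h2 : ‖x * xᴴ‖ ≤ 1 := (CStarAlgebra.norm_le_one_iff_of_nonneg _ hnn).mpr h1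
    have h3 : ‖x * xᴴ‖ ≠ 1 := by
      intro h3
      have h4 := CStarAlgebra.norm_mem_spectrum_of_nonneg (a := x * xᴴ) hnn
      rw [h3, spectrum.mem_iff, map_one] at h4
      exact h4 h.isUnit
    have h4 : ‖x * xᴴ‖ < 1 := lt_of_le_of_ne h2 h3
    rw [hnorm] at h4
    nlinarith [norm_nonneg x]
  · intro h
    have h4 : ‖x * xᴴ‖ < 1 := by rw [hnorm]; nlinarith [norm_nonneg x]
    have h1 : x * xᴴ ≤ 1 := (CStarAlgebra.norm_le_one_iff_of_nonneg _ hnn).mp h4.le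
    have h5 : (1 - x * xᴴ).PosSemidef := Matrix.le_iff.mp h1
    exact h5.posDef_iff_isUnit.mpr (isUnit_one_sub_of_norm_lt_one h4)

theorem siegel_posDef_iff' {n : ℕ} (x : Matrix (Fin n) (Fin n) ℂ) : (1 - xᴴ * x).PosDef ↔ ‖x‖ < 1 := by
  have := siegel_posDef_iff xᴴ
  rwa [Matrix.conjTranspose_conjTranspose, Matrix.l2_opNorm_conjTranspose] at this

theorem siegel_sqrt_mul {n : ℕ} (x : Matrix (Fin n) (Fin n) ℂ) (hx : ‖x‖ < 1) :
    CFC.sqrt (1 - x * xᴴ) * x = x * CFC.sqrt (1 - xᴴ * x) := by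
  set p := CFC.sqrt (1 - x * xᴴ) with hp
  set q := CFC.sqrt (1 - xᴴ * x) with hq
  have hP := (siegel_posDef_iff x).mpr hx
  have hQ := (siegel_posDef_iff' x).mpr hx
  have hpp : p * p = 1 - x * xᴴ := CFC.sqrt_mul_sqrt_self _ hP.posSemidef.nonneg
  have hqq : q * q = 1 - xᴴ * x := CFC.sqrt_mul_sqrt_self _ hQ.posSemidef.nonneg
  have hp0 : 0 ≤ p := CFC.sqrt_nonneg _
  have hq0 : 0 ≤ q := CFC.sqrt_nonneg _
  have hqu : IsUnit q := (CFC.isUnit_sqrt_iff _ hQ.posSemidef.nonneg).mpr hQ.isUnit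
  set W := p * x - x * q with hW
  have key : p * W = -(W * q) := by
    have e : p * p * x = x * (q * q) := by rw [hpp, hqq]; noncomm_ring
    have : p * W + W * q = p * p * x - x * (q * q) := by rw [hW]; noncomm_ring
    rw [e, sub_self] at this
    exact eq_neg_of_add_eq_zero_left this
  have hps : pᴴ = p := hp0.isSelfAdjoint
  have hqs : qᴴ = q := hq0.isSelfAdjoint
  have h1 : Wᴴ * p * W = -(Wᴴ * W * q) := by rw [mul_assoc, key]; noncomm_ring
  have h2 : Wᴴ * p * W = -(q * (Wᴴ * W)) := by
    have := congrArg Matrix.conjTranspose h1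
    simpa [Matrix.conjTranspose_mul, hps, hqs, mul_assoc] using this
  have hc : Commute (Wᴴ * W) q := by
    have := h1.symm.trans h2
    exact neg_injective this
  have hWW : 0 ≤ Wᴴ * W := star_mul_self_nonneg W
  have h3 : 0 ≤ Wᴴ * W * q := hc.mul_nonneg hWW hq0
  have h4 : 0 ≤ Wᴴ * p * W := star_left_conjugate_nonneg hp0 W
  have h5 : Wᴴ * W * q = 0 := le_antisymm (by rw [h1] at h4; exact neg_nonneg.mp h4) h3
  have h6 : Wᴴ * W = 0 := hqu.mul_left_eq_zero.mp h5
  have h7 : W = 0 := Matrix.conjTranspose_mul_self_eq_zero.mp h6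
  exact sub_eq_zero.mp h7
theorem mem_siegelDisk_iff {n : ℕ} (x : symMatrix n) : x ∈ siegelDisk n ↔ ‖x‖ < 1 :=
  siegel_posDef_iff (x : Matrix (Fin n) (Fin n) ℂ)

theorem siegel_norm_lt {n : ℕ} (x : siegelDisk n) :
    ‖((x : symMatrix n) : Matrix (Fin n) (Fin n) ℂ)‖ < 1 :=
  (mem_siegelDisk_iff _).mp x.2

theorem siegel_mul_inv {n : ℕ} {a : Matrix (Fin n) (Fin n) ℂ} (h : IsUnit a) : a * a⁻¹ = 1 :=
  Matrix.mul_nonsing_inv a ((Matrix.isUnit_iff_isUnit_det a).mp h)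

theorem siegel_inv_mul {n : ℕ} {a : Matrix (Fin n) (Fin n) ℂ} (h : IsUnit a) : a⁻¹ * a = 1 :=
  Matrix.nonsing_inv_mul a ((Matrix.isUnit_iff_isUnit_det a).mp h)

theorem siegel_isUnit {n : ℕ} {x y : Matrix (Fin n) (Fin n) ℂ} (hx : ‖x‖ < 1) (hy : ‖y‖ < 1) :
    IsUnit (1 - xᴴ * y) := by
  apply isUnit_one_sub_of_norm_lt_one
  calc ‖xᴴ * y‖ ≤ ‖xᴴ‖ * ‖y‖ := norm_mul_le _ _
    _ < 1 := by
      rw [Matrix.l2_opNorm_conjTranspose]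
      nlinarith [norm_nonneg x, norm_nonneg y]

/-! Identities in a ring; `s` stands for the adjoint of `x`, and a prime for an inverse. -/

theorem siegel_ring_facts {R : Type*} [Ring R] {x s p q p' q' : R}
    (hpp : p * p = 1 - x * s) (hqq : q * q = 1 - s * x) (h1 : p * x = x * q)
    (h2 : q * s = s * p) (p1 : p' * p = 1) (p2 : p * p' = 1) (q1 : q' * q = 1)
    (q2 : q * q' = 1) :
    p' * x = x * q' ∧ s * p' = q' * s ∧ p' * p' = 1 + x * (q' * q') * s ∧
      s * (p' * p') * x = q' * q' - 1 := by
  have a1 : p' * x = x * q' := by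
    calc p' * x = p' * (x * q) * q' := by rw [mul_assoc, mul_assoc, q2, mul_one]
      _ = (p' * p) * x * q' := by rw [← h1]; noncomm_ring
      _ = x * q' := by rw [p1, one_mul]
  have a2 : s * p' = q' * s := by
    calc s * p' = (q' * q) * s * p' := by rw [q1, one_mul]
      _ = q' * (q * s) * p' := by noncomm_ring
      _ = q' * s * (p * p') := by rw [h2]; noncomm_ring
      _ = q' * s := by rw [p2, mul_one]
  refine ⟨a1, a2, ?_, ?_⟩
  · have e : x * s = 1 - p * p := by rw [hpp]; noncomm_ring
    calc p' * p' = p' * p' * (p * p + x * s) := by rw [hpp]; noncomm_ring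
      _ = p' * (p' * p) * p + p' * (p' * x) * s := by noncomm_ring
      _ = 1 + (p' * x) * q' * s := by rw [p1, mul_one, p1, a1, ← mul_assoc, a1]
      _ = 1 + x * (q' * q') * s := by rw [a1]; noncomm_ring
  · calc s * (p' * p') * x = (s * p') * (p' * x) := by noncomm_ring
      _ = q' * (s * x) * q' := by rw [a1, a2]; noncomm_ring
      _ = q' * (1 - q * q) * q' := by rw [hqq]; noncomm_ring
      _ = q' * q' - (q' * q) * (q * q') := by noncomm_ring
      _ = q' * q' - 1 := by rw [q1, q2, one_mul]

theorem siegel_ring_inverse {R : Type*} [Ring R] {x s y p q p' q' b b' : R}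
    (hpp : p * p = 1 - x * s) (hqq : q * q = 1 - s * x) (h1 : p * x = x * q)
    (h2 : q * s = s * p) (p1 : p' * p = 1) (p2 : p * p' = 1) (q1 : q' * q = 1)
    (q2 : q * q' = 1) (b1 : b' * b = 1) (b2 : b * b' = 1) (hb : b = 1 - s * y) :
    p' * (y - x) * b' * q + x = p * y * b' * q ∧
      1 + s * (p' * (y - x) * b' * q) = q * b' * q ∧
      q * b' * q * (q' * b * q') = 1 ∧
      p' * (p * y * b' * q) * (q' * b * q') * q = y := by
  obtain ⟨-, a2, -, -⟩ := siegel_ring_facts hpp hqq h1 h2 p1 p2 q1 q2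
  refine ⟨?_, ?_, ?_, ?_⟩
  · have : x = p' * x * (b * b') * q := by
      rw [b2, mul_one, mul_assoc, ← h1, ← mul_assoc, p1, one_mul]
    calc p' * (y - x) * b' * q + x
        = p' * (y - x) * b' * q + p' * x * (b * b') * q := by rw [← this]
      _ = p' * ((y - x) + x * b) * b' * q := by noncomm_ring
      _ = p' * (p * p * y) * b' * q := by rw [hpp, hb]; noncomm_ring
      _ = (p' * p) * p * y * b' * q := by noncomm_ring
      _ = p * y * b' * q := by rw [p1, one_mul]
  · calc 1 + s * (p' * (y - x) * b' * q)
        = q' * (b * b') * q + (s * p') * (y - x) * b' * q := by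
          rw [b2, mul_one, q1]; noncomm_ring
      _ = q' * (b + s * (y - x)) * b' * q := by rw [a2]; noncomm_ring
      _ = q' * (q * q) * b' * q := by rw [hqq, hb]; noncomm_ring
      _ = (q' * q) * q * b' * q := by noncomm_ring
      _ = q * b' * q := by rw [q1, one_mul]
  · calc q * b' * q * (q' * b * q') = q * b' * (q * q') * b * q' := by noncomm_ring
      _ = q * (b' * b) * q' := by rw [q2]; noncomm_ring
      _ = 1 := by rw [b1, mul_one, q2]
  · calc p' * (p * y * b' * q) * (q' * b * q') * q
        = (p' * p) * y * b' * (q * q') * b * (q' * q) := by noncomm_ring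
      _ = y * (b' * b) := by rw [p1, q1, q2]; noncomm_ring
      _ = y := by rw [b1, mul_one]

theorem siegel_ring_norm {R : Type*} [Ring R] {x s y t p q p' q' b b' c c' : R}
    (hpp : p * p = 1 - x * s) (hqq : q * q = 1 - s * x) (h1 : p * x = x * q)
    (h2 : q * s = s * p) (p1 : p' * p = 1) (p2 : p * p' = 1) (q1 : q' * q = 1)
    (q2 : q * q' = 1) (b2 : b * b' = 1) (c1 : c' * c = 1) (hb : b = 1 - s * y)
    (hc : c = 1 - t * x) :
    1 - q * (c' * ((t - s) * p')) * (p' * (y - x) * b' * q)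
      = q * c' * (1 - t * y) * (b' * q) := by
  obtain ⟨a1, a2, a3, a4⟩ := siegel_ring_facts hpp hqq h1 h2 p1 p2 q1 q2
  have key : c * (q' * q') * b - (t - s) * (p' * p') * (y - x) = 1 - t * y := by
    have e : (t - s) * (p' * p') * (y - x) =
        t * (p' * p') * y - t * (p' * (p' * x)) - ((s * p') * p') * y
          + s * (p' * p') * x := by noncomm_ring
    have e1 : p' * (p' * x) = x * (q' * q') := by rw [a1, ← mul_assoc, a1, mul_assoc]
    have e2 : (s * p') * p' = q' * q' * s := by rw [a2, mul_assoc, a2, mul_assoc]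
    rw [e, e1, e2, a4, a3, hc, hb]
    noncomm_ring
  have e : q * c' * (c * (q' * q') * b) * (b' * q) = 1 := by
    calc q * c' * (c * (q' * q') * b) * (b' * q)
        = q * (c' * c) * (q' * q') * (b * b') * q := by noncomm_ring
      _ = (q * q') * (q' * q) := by rw [c1, b2]; noncomm_ring
      _ = 1 := by rw [q1, q2, one_mul]
  rw [← key, mul_sub (q * c'), sub_mul _ _ (b' * q), e]
  noncomm_ring

theorem siegel_ring_symm {R : Type*} [Ring R] {x s y p q p' q' b b' c c' : R}
    (hpp : p * p = 1 - x * s) (hqq : q * q = 1 - s * x) (h1 : p * x = x * q)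
    (h2 : q * s = s * p) (p1 : p' * p = 1) (p2 : p * p' = 1) (q1 : q' * q = 1)
    (q2 : q * q' = 1) (b2 : b * b' = 1) (c1 : c' * c = 1) (hb : b = 1 - s * y)
    (hc : c = 1 - y * s) :
    p * (c' * ((y - x) * q')) = p' * (y - x) * b' * q := by
  obtain ⟨a1, a2, a3, a4⟩ := siegel_ring_facts hpp hqq h1 h2 p1 p2 q1 q2
  have key : c * (p' * p') * (y - x) = (y - x) * (q' * q') * b := by
    have e : c * (p' * p') * (y - x) = (p' * p') * y - (p' * (p' * x))
        - y * ((s * p') * p') * y + y * (s * (p' * p') * x) := by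
      rw [hc]; noncomm_ring
    have e1 : p' * (p' * x) = x * (q' * q') := by rw [a1, ← mul_assoc, a1, mul_assoc]
    have e2 : (s * p') * p' = q' * q' * s := by rw [a2, mul_assoc, a2, mul_assoc]
    rw [e, e1, e2, a4, a3, hb]
    noncomm_ring
  calc p * (c' * ((y - x) * q'))
      = p * c' * ((y - x) * q') * (q' * (b * b') * q) := by
        rw [b2, mul_one, q1]; noncomm_ring
    _ = p * c' * ((y - x) * (q' * q') * b) * b' * q := by noncomm_ring
    _ = p * (c' * c) * (p' * p') * (y - x) * b' * q := by rw [← key]; noncomm_ring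
    _ = (p * p') * p' * (y - x) * b' * q := by rw [c1]; noncomm_ring
    _ = p' * (y - x) * b' * q := by rw [p2, one_mul]

/-- The square roots in `siegelFormula` and their basic properties. -/
theorem siegel_sqrt {n : ℕ} {x : Matrix (Fin n) (Fin n) ℂ} (hx : ‖x‖ < 1) :
    ∃ p q : Matrix (Fin n) (Fin n) ℂ,
      p = CFC.sqrt (1 - x * xᴴ) ∧ q = CFC.sqrt (1 - xᴴ * x) ∧
      p * p = 1 - x * xᴴ ∧ q * q = 1 - xᴴ * x ∧ IsUnit p ∧ IsUnit q ∧ pᴴ = p ∧ qᴴ = q ∧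
      p * x = x * q ∧ q * xᴴ = xᴴ * p := by
  have hP := (siegel_posDef_iff x).mpr hx
  have hQ := (siegel_posDef_iff' x).mpr hx
  have hps : (CFC.sqrt (1 - x * xᴴ))ᴴ = CFC.sqrt (1 - x * xᴴ) :=
    (CFC.sqrt_nonneg (1 - x * xᴴ)).isSelfAdjoint
  have hqs : (CFC.sqrt (1 - xᴴ * x))ᴴ = CFC.sqrt (1 - xᴴ * x) :=
    (CFC.sqrt_nonneg (1 - xᴴ * x)).isSelfAdjoint
  have h := siegel_sqrt_mul x hx
  refine ⟨_, _, rfl, rfl, CFC.sqrt_mul_sqrt_self _ hP.posSemidef.nonneg,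
    CFC.sqrt_mul_sqrt_self _ hQ.posSemidef.nonneg,
    (CFC.isUnit_sqrt_iff _ hP.posSemidef.nonneg).mpr hP.isUnit,
    (CFC.isUnit_sqrt_iff _ hQ.posSemidef.nonneg).mpr hQ.isUnit, hps, hqs, h, ?_⟩
  have := congrArg Matrix.conjTranspose h
  rw [Matrix.conjTranspose_mul, Matrix.conjTranspose_mul, hps, hqs] at this
  exact this.symm

theorem siegelFormula_neg {n : ℕ} {x y : Matrix (Fin n) (Fin n) ℂ} (hx : ‖x‖ < 1)
    (hy : ‖y‖ < 1) : siegelFormula (-x) (siegelFormula x y) = y := by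
  obtain ⟨p, q, hp, hq, hpp, hqq, hpu, hqu, -, -, h1, h2⟩ := siegel_sqrt hx
  have hB := siegel_isUnit hx hy
  obtain ⟨e1, e2, e3, e4⟩ := siegel_ring_inverse hpp hqq h1 h2 (siegel_inv_mul hpu)
    (siegel_mul_inv hpu) (siegel_inv_mul hqu) (siegel_mul_inv hqu) (siegel_inv_mul hB)
    (siegel_mul_inv hB) rfl
  unfold siegelFormula
  simp only [Matrix.conjTranspose_neg, sub_neg_eq_add, neg_mul, mul_neg, neg_neg]
  rw [← hp, ← hq, e1, e2, Matrix.inv_eq_right_inv e3, e4]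

theorem siegelFormula_norm_lt {n : ℕ} {x y : Matrix (Fin n) (Fin n) ℂ} (hx : ‖x‖ < 1)
    (hy : ‖y‖ < 1) : ‖siegelFormula x y‖ < 1 := by
  obtain ⟨p, q, hp, hq, hpp, hqq, hpu, hqu, hps, hqs, h1, h2⟩ := siegel_sqrt hx
  have hB := siegel_isUnit hx hy
  have hC := siegel_isUnit hy hx
  have hBH : (1 - xᴴ * y)ᴴ = 1 - yᴴ * x := by
    rw [Matrix.conjTranspose_sub, Matrix.conjTranspose_mul, Matrix.conjTranspose_one,
      Matrix.conjTranspose_conjTranspose]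
  have hring := siegel_ring_norm hpp hqq h1 h2 (siegel_inv_mul hpu)
    (siegel_mul_inv hpu) (siegel_inv_mul hqu) (siegel_mul_inv hqu)
    (siegel_mul_inv hB) (siegel_inv_mul hC) rfl rfl
  have hCu : IsUnit ((1 - xᴴ * y)⁻¹ * q) := (Matrix.isUnit_nonsing_inv_iff.mpr hB).mul hqu
  have e1 : (siegelFormula x y)ᴴ = q * ((1 - yᴴ * x)⁻¹ * ((yᴴ - xᴴ) * p⁻¹)) := by
    unfold siegelFormula
    rw [← hp, ← hq, Matrix.conjTranspose_mul, Matrix.conjTranspose_mul,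
      Matrix.conjTranspose_mul, Matrix.conjTranspose_nonsing_inv,
      Matrix.conjTranspose_nonsing_inv, hps, hqs, hBH, Matrix.conjTranspose_sub]
  have e2 : siegelFormula x y = p⁻¹ * (y - x) * (1 - xᴴ * y)⁻¹ * q := by
    unfold siegelFormula
    rw [← hp, ← hq]
  have e3 : ((1 - xᴴ * y)⁻¹ * q)ᴴ = q * (1 - yᴴ * x)⁻¹ := by
    rw [Matrix.conjTranspose_mul, Matrix.conjTranspose_nonsing_inv, hqs, hBH]
  have fin : 1 - (siegelFormula x y)ᴴ * siegelFormula x y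
      = ((1 - xᴴ * y)⁻¹ * q)ᴴ * (1 - yᴴ * y) * ((1 - xᴴ * y)⁻¹ * q) := by
    rw [e1, e2, e3, hring]
  rw [← siegel_posDef_iff', fin]
  exact ((siegel_posDef_iff' y).mpr hy).conjTranspose_mul_mul_same
    (Matrix.mulVec_injective_iff_isUnit.mpr hCu)

theorem siegelFormula_transpose {n : ℕ} {x y : Matrix (Fin n) (Fin n) ℂ} (hx : ‖x‖ < 1)
    (hy : ‖y‖ < 1) (hxs : xᵀ = x) (hys : yᵀ = y) :
    (siegelFormula x y)ᵀ = siegelFormula x y := by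
  obtain ⟨p, q, hp, hq, hpp, hqq, hpu, hqu, hps, hqs, h1, h2⟩ := siegel_sqrt hx
  have hB := siegel_isUnit hx hy
  have hxs' : xᴴᵀ = xᴴ := by
    have : xᴴᵀ = xᵀᴴ := rfl
    rw [this, hxs]
  have hqp : qᵀ = p := by
    rw [hp, eq_comm]
    refine CFC.sqrt_unique ?_ ?_
    · rw [← Matrix.transpose_mul, hqq, Matrix.transpose_sub, Matrix.transpose_mul, hxs, hxs',
        Matrix.transpose_one]
    · have h0 : 0 ≤ q := by rw [hq]; exact CFC.sqrt_nonneg _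
      exact (Matrix.nonneg_iff_posSemidef.mp h0).transpose.nonneg
  have hpq : pᵀ = q := by rw [← hqp, Matrix.transpose_transpose]
  have hBT : (1 - xᴴ * y)ᵀ = 1 - y * xᴴ := by
    rw [Matrix.transpose_sub, Matrix.transpose_mul, hxs', hys, Matrix.transpose_one]
  have c1 : (1 - y * xᴴ)⁻¹ * (1 - y * xᴴ) = 1 := by
    rw [← hBT, ← Matrix.transpose_nonsing_inv, ← Matrix.transpose_mul, siegel_mul_inv hB,
      Matrix.transpose_one]
  unfold siegelFormula
  rw [← hp, ← hq, Matrix.transpose_mul, Matrix.transpose_mul, Matrix.transpose_mul,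
    Matrix.transpose_nonsing_inv, Matrix.transpose_nonsing_inv, hBT, Matrix.transpose_sub, hqp,
    hpq, hxs, hys]
  exact siegel_ring_symm hpp hqq h1 h2 (siegel_inv_mul hpu)
    (siegel_mul_inv hpu) (siegel_inv_mul hqu) (siegel_mul_inv hqu)
    (siegel_mul_inv hB) c1 rfl rfl

/-- The map `φ_x : y ↦ (I - x xᴴ)^(-1/2) (y - x) (I - xᴴ y)⁻¹ (I - xᴴ x)^(1/2)` of the Siegel disk
to itself. -/
noncomputable def siegelMap {n : ℕ} (x y : siegelDisk n) : siegelDisk n :=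
  ⟨⟨siegelFormula x y,
      siegelFormula_transpose (siegel_norm_lt x) (siegel_norm_lt y) x.1.2 y.1.2⟩,
    (mem_siegelDisk_iff _).mpr (siegelFormula_norm_lt (siegel_norm_lt x) (siegel_norm_lt y))⟩

/-- The point `-x` of the Siegel disk. -/
def siegelNeg {n : ℕ} (x : siegelDisk n) : siegelDisk n :=
  ⟨-x.1, (mem_siegelDisk_iff _).mpr (by rw [norm_neg]; exact (mem_siegelDisk_iff _).mp x.2)⟩

/-- The automorphism `φ_x` of the Siegel disk, as a bijection; `(siegelAut x).symm` is the inverse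
map of `φ_x`. -/
noncomputable def siegelAut {n : ℕ} (x : siegelDisk n) : siegelDisk n ≃ siegelDisk n where
  toFun := siegelMap x
  invFun := siegelMap (siegelNeg x)
  left_inv y := Subtype.ext (Subtype.ext
    (siegelFormula_neg (siegel_norm_lt x) (siegel_norm_lt y)))
  right_inv y := by
    refine Subtype.ext (Subtype.ext ?_)
    have h := siegelFormula_neg (siegel_norm_lt (siegelNeg x)) (siegel_norm_lt y)
    have e : -((siegelNeg x : symMatrix n) : Matrix (Fin n) (Fin n) ℂ) = x := neg_neg _
    rw [e] at h
    exact h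

/-- The identity element of the Siegel disk, the zero matrix. -/
def siegelZero (n : ℕ) : siegelDisk n :=
  ⟨0, (mem_siegelDisk_iff _).mpr (by rw [norm_zero]; exact one_pos)⟩

/-- The multiple `t x` of a point of the Siegel disk by a real number `t ∈ [0,1]`. -/
noncomputable def siegelScale {n : ℕ} (t : Set.Icc (0 : ℝ) 1) (x : siegelDisk n) : siegelDisk n :=
  ⟨((t : ℝ) : ℂ) • (x : symMatrix n), (mem_siegelDisk_iff _).mpr (by
    have hx := (mem_siegelDisk_iff _).mp x.2
    have ht := t.2
    rw [norm_smul, Complex.norm_real, Real.norm_eq_abs, abs_of_nonneg ht.1]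
    nlinarith [ht.1, ht.2, norm_nonneg (x : symMatrix n)])⟩

/-- The scalar multiplication `t ⊗ x = φ_0⁻¹ (t φ_0 x)` on the Siegel disk. -/
noncomputable def siegelSMul {n : ℕ} (t : Set.Icc (0 : ℝ) 1) (x : siegelDisk n) : siegelDisk n :=
  (siegelAut (siegelZero n)).symm (siegelScale t (siegelAut (siegelZero n) x))

/-- `γ : [0,1] → SD_n` is an almost geodesic of the Siegel disk joining `x` and `y`, for the
automorphisms `φ_x`, the identity element `0`, the scalar multiplication `⊗`, and the Kobayashi
pseudodistance of the Siegel disk as a domain in the space of complex symmetric matrices. -/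
def IsSiegelAlmostGeodesic {n : ℕ} (x y : siegelDisk n)
    (γ : Set.Icc (0 : ℝ) 1 → siegelDisk n) : Prop :=
  IsAlmostGeodesic siegelAut (siegelZero n) siegelSMul
    (fun a b => kobayashiDist (siegelDisk n) (a : symMatrix n) (b : symMatrix n)) x y γ

/-! ## The Schwarz–Pick lemma at the centre of the disc -/

/-! The Siegel disk is the open unit ball of the spectral norm, and in the unit ball of any complex
normed space the Kobayashi distance from `0` to `w` is `artanh ‖w‖` (`kobayashiDist_ball_zero`). For
the upper bound, the complex line through `w` meets the ball in a disc, and Möbius maps of that disc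
bound the metric along the segment from `0` to `w`. For the lower bound, a norming functional of `w`
maps the ball into the unit disc, where Schwarz–Pick applies.

Since `φ_0` is the identity, `⊗` is ordinary scaling. With `r = ‖z‖` the condition on `α` becomes
`artanh (α t * r) = t * artanh r`, that is `α t * r = tanh (t * artanh r)`, and
`Real.tanh_mul_artanh` turns this into the stated powers. If `r ≠ 0` this determines `α`; if `r = 0`
it leaves `α` free, but every multiple of `z = 0` is the same point, so the curve is unique in both
cases. -/

theorem Complex.normSq_one_sub_conj_mul_sub (a u : ℂ) :
    Complex.normSq (1 - starRingEnd ℂ a * u) - Complex.normSq (u - a)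
      = (1 - Complex.normSq a) * (1 - Complex.normSq u) := by
  simp only [Complex.normSq_apply, Complex.sub_re, Complex.sub_im, Complex.mul_re, Complex.mul_im,
    Complex.one_re, Complex.one_im, Complex.conj_re, Complex.conj_im]
  ring

theorem Complex.one_sub_conj_mul_ne_zero {a u : ℂ} (ha : ‖a‖ < 1) (hu : ‖u‖ < 1) :
    1 - starRingEnd ℂ a * u ≠ 0 := by
  intro h
  have h1 : ‖starRingEnd ℂ a * u‖ = 1 := by rw [← sub_eq_zero.mp h, norm_one]
  rw [norm_mul, RCLike.norm_conj] at h1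
  nlinarith [norm_nonneg a, norm_nonneg u]

theorem Complex.norm_moebius_lt_one {a u : ℂ} (ha : ‖a‖ < 1) (hu : ‖u‖ < 1) :
    ‖(u - a) / (1 - starRingEnd ℂ a * u)‖ < 1 := by
  have h0 := Complex.one_sub_conj_mul_ne_zero ha hu
  rw [norm_div, div_lt_one (norm_pos_iff.mpr h0)]
  have h := Complex.normSq_one_sub_conj_mul_sub a u
  simp only [Complex.normSq_eq_norm_sq] at h
  have : 0 < (1 - ‖a‖ ^ 2) * (1 - ‖u‖ ^ 2) :=
    mul_pos (by nlinarith [norm_nonneg a]) (by nlinarith [norm_nonneg u])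
  exact lt_of_pow_lt_pow_left₀ 2 (norm_nonneg _) (by linarith)

theorem Complex.hasDerivAt_moebius {a u : ℂ} (ha : ‖a‖ < 1) (hu : ‖u‖ < 1) :
    HasDerivAt (fun w : ℂ => (w - a) / (1 - starRingEnd ℂ a * w))
      ((1 - starRingEnd ℂ a * a) / (1 - starRingEnd ℂ a * u) ^ 2) u := by
  have h0 := Complex.one_sub_conj_mul_ne_zero ha hu
  have h := ((hasDerivAt_id u).sub_const a).div
    (((hasDerivAt_id u).const_mul (starRingEnd ℂ a)).const_sub 1) h0
  refine h.congr_deriv ?_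
  simp only [id]
  ring

theorem Complex.conj_mul_self_eq_norm_sq (a : ℂ) :
    starRingEnd ℂ a * a = ((‖a‖ ^ 2 : ℝ) : ℂ) := by
  rw [mul_comm, Complex.mul_conj, Complex.normSq_eq_norm_sq]

/-- The **Schwarz–Pick lemma** at the centre of the disc. -/
theorem Complex.norm_deriv_zero_le_one_sub_sq {f : ℂ → ℂ}
    (hd : DifferentiableOn ℂ f (Metric.ball 0 1))
    (hm : Set.MapsTo f (Metric.ball 0 1) (Metric.ball 0 1)) :
    ‖deriv f 0‖ ≤ 1 - ‖f 0‖ ^ 2 := by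
  have h0 : (0 : ℂ) ∈ Metric.ball (0 : ℂ) 1 := Metric.mem_ball_self one_pos
  set a := f 0 with ha_def
  have hn : ∀ z ∈ Metric.ball (0 : ℂ) 1, ‖f z‖ < 1 := fun z hz => mem_ball_zero_iff.mp (hm hz)
  have ha : ‖a‖ < 1 := hn 0 h0
  -- The Möbius map `m` moves `f 0` to `0`, so the Schwarz lemma applies to `m ∘ f`; its derivative
  -- at `a` is `1 / (1 - ‖a‖ ^ 2)`.
  set m : ℂ → ℂ := fun w => (w - a) / (1 - starRingEnd ℂ a * w) with hm_def
  have hma : m a = 0 := by simp [hm_def]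
  have hpos : 0 < 1 - ‖a‖ ^ 2 := by nlinarith [norm_nonneg a]
  have hD : DifferentiableOn ℂ (m ∘ f) (Metric.ball 0 1) := fun z hz =>
    (Complex.hasDerivAt_moebius ha (hn z hz)).differentiableAt.comp_differentiableWithinAt z
      (hd z hz)
  have hM : Set.MapsTo (m ∘ f) (Metric.ball 0 1) (Metric.closedBall ((m ∘ f) 0) 1) := by
    intro z hz
    rw [Function.comp_apply, ← ha_def, hma, mem_closedBall_zero_iff]
    exact (Complex.norm_moebius_lt_one ha (hn z hz)).le
  have hS := Complex.norm_deriv_le_one_of_mapsTo_ball hD hM one_pos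
  have hf : HasDerivAt f (deriv f 0) 0 :=
    ((hd 0 h0).differentiableAt (Metric.isOpen_ball.mem_nhds h0)).hasDerivAt
  have hc := (Complex.hasDerivAt_moebius ha ha).comp (0 : ℂ) hf
  rw [hc.deriv, norm_mul, norm_div, norm_pow, Complex.conj_mul_self_eq_norm_sq,
    ← Complex.ofReal_one, ← Complex.ofReal_sub, Complex.norm_real, Real.norm_of_nonneg hpos.le,
    sq (1 - ‖a‖ ^ 2), div_mul_cancel_left₀ hpos.ne', inv_mul_le_iff₀ hpos, mul_one] at hS
  exact hS

/-! ### Smoothness of `artanh`, the primitive of the Poincaré density on the real diameter -/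

theorem Real.hasDerivAt_artanh {x : ℝ} (hx : x ∈ Set.Ioo (-1 : ℝ) 1) :
    HasDerivAt Real.artanh (1 / (1 - x ^ 2)) x := by
  have h1 : 0 < 1 + x := by linarith [hx.1]
  have h2 : 0 < 1 - x := by linarith [hx.2]
  have h : HasDerivAt (fun y : ℝ => 1 / 2 * (Real.log (1 + y) - Real.log (1 - y)))
      (1 / 2 * (1 / (1 + x) - -1 / (1 - x))) x :=
    ((((hasDerivAt_id x).const_add 1).log h1.ne').sub
      (((hasDerivAt_id x).const_sub 1).log h2.ne')).const_mul _
  have he : Real.artanh =ᶠ[nhds x] fun y : ℝ => 1 / 2 * (Real.log (1 + y) - Real.log (1 - y)) := by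
    filter_upwards [isOpen_Ioo.mem_nhds hx] with y hy
    rw [Real.artanh_eq_half_log ⟨hy.1.le, hy.2.le⟩, Real.log_div (by linarith [hy.1])
      (by linarith [hy.2])]
  refine (h.congr_of_eventuallyEq he).congr_deriv ?_
  have h3 : 1 - x ^ 2 ≠ 0 := by nlinarith
  field_simp
  ring

theorem Real.contDiffAt_artanh {x : ℝ} (hx : x ∈ Set.Ioo (-1 : ℝ) 1) :
    ContDiffAt ℝ 1 Real.artanh x := by
  have h1 : 0 < 1 + x := by linarith [hx.1]
  have h2 : 0 < 1 - x := by linarith [hx.2]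
  have h3 : 0 < (1 + x) / (1 - x) := div_pos h1 h2
  unfold Real.artanh
  exact (((contDiffAt_const.add contDiffAt_id).div (contDiffAt_const.sub contDiffAt_id)
    h2.ne').sqrt h3.ne').log (Real.sqrt_pos.mpr h3).ne'

/-! ## The Kobayashi distance from the centre of the unit ball of a complex normed space -/

section UnitBall

variable {E : Type*} [NormedAddCommGroup E] [NormedSpace ℂ E]

/-- A constant disc competes for every `τ`, so `1 / τ` can be made arbitrarily small. -/
theorem kobayashiMetric_zero_right {D : Set E} {x : E} (hx : x ∈ D) : kobayashiMetric D x 0 = 0 := by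
  refine nonpos_iff_eq_zero.mp (ENNReal.le_of_forall_pos_le_add fun ε hε _ => ?_)
  rw [zero_add]
  have hε' : (0 : ℝ) < ε := hε
  refine sInf_le ⟨1 / ε, fun _ => x, one_div_pos.mpr hε', analyticOnNhd_const, fun _ _ => hx, rfl,
    by simp, ?_⟩
  rw [one_div_one_div, ENNReal.ofReal_coe_nnreal]

/-- The competitor is a Möbius map of the disc, sending `0` to `a = t * ‖w‖`, followed by the linear
embedding of the disc along the unit vector of `w`. Its derivative at `0` is `1 - a ^ 2` times that
vector, whence `τ = (1 - a ^ 2) / ‖w‖`. -/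
theorem kobayashiMetric_ball_smul_le {w : E} (hw : w ≠ 0) {t : ℝ} (ht : |t| * ‖w‖ < 1) :
    kobayashiMetric (Metric.ball (0 : E) 1) (t • w) w
      ≤ ENNReal.ofReal (‖w‖ / (1 - (t * ‖w‖) ^ 2)) := by
  have hr : 0 < ‖w‖ := norm_pos_iff.mpr hw
  set a : ℝ := t * ‖w‖ with ha_def
  have ha : |a| < 1 := by rwa [ha_def, abs_mul, abs_norm]
  have hpos : 0 < 1 - a ^ 2 := by nlinarith [sq_abs a, abs_nonneg a]
  have hna : ‖(-(a : ℂ))‖ < 1 := by rwa [norm_neg, Complex.norm_real, Real.norm_eq_abs]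
  set m : ℂ → ℂ := fun z => (z - -(a : ℂ)) / (1 - starRingEnd ℂ (-(a : ℂ)) * z) with hm_def
  set u : E := ((‖w‖⁻¹ : ℝ) : ℂ) • w with hu_def
  have hu : ‖u‖ = 1 := by
    rw [hu_def, norm_smul, Complex.norm_real, norm_inv, norm_norm, inv_mul_cancel₀ hr.ne']
  have hn : ∀ z ∈ Metric.ball (0 : ℂ) 1, ‖z‖ < 1 := fun z hz => mem_ball_zero_iff.mp hz
  have hmd := Complex.hasDerivAt_moebius hna (u := 0) (by simp)
  refine sInf_le ⟨(1 - a ^ 2) / ‖w‖, fun z => m z • u, by positivity, ?_, ?_, ?_, ?_, ?_⟩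
  · refine AnalyticOnNhd.smul ?_ analyticOnNhd_const
    exact DifferentiableOn.analyticOnNhd (fun z hz =>
      (Complex.hasDerivAt_moebius hna (hn z hz)).differentiableAt.differentiableWithinAt)
      Metric.isOpen_ball
  · intro z hz
    rw [mem_ball_zero_iff, norm_smul, hu, mul_one]
    exact Complex.norm_moebius_lt_one hna (hn z hz)
  · have : m 0 = (a : ℂ) := by simp [hm_def]
    simp only [this]
    rw [hu_def, smul_smul, ← Complex.ofReal_mul, ha_def, mul_assoc, mul_inv_cancel₀ hr.ne', mul_one,
      Complex.coe_smul]
  · rw [(hmd.smul_const u).deriv, hu_def, smul_smul]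
    congr 1
    simp [div_eq_mul_inv, sq]
  · rw [one_div_div]

/-- Composing a competing disc with `l` gives a self-map of the unit disc, so Schwarz–Pick yields `τ
* ‖l v‖ ≤ 1 - ‖l x‖ ^ 2`. Passing to real parts only weakens this, and makes the bound the speed of
the real function `artanh (l γ).re` along a curve. -/
theorem le_kobayashiMetric_ball (l : E →L[ℂ] ℂ) (hl : ‖l‖ ≤ 1) {x v : E} :
    ENNReal.ofReal (|(l v).re| / (1 - (l x).re ^ 2))
      ≤ kobayashiMetric (Metric.ball (0 : E) 1) x v := by
  refine le_sInf ?_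
  rintro r ⟨τ, h, hτ, hh, hm, h0, hd, rfl⟩
  refine ENNReal.ofReal_le_ofReal ?_
  have hle : ∀ y : E, ‖l y‖ ≤ ‖y‖ := fun y => by
    simpa using l.le_of_opNorm_le hl y
  have hb : (0 : ℂ) ∈ Metric.ball (0 : ℂ) 1 := Metric.mem_ball_self one_pos
  have hS := Complex.norm_deriv_zero_le_one_sub_sq (f := fun z => l (h z))
    (fun z hz => (l.differentiableAt.comp z (hh z hz).differentiableAt).differentiableWithinAt)
    (fun z hz => mem_ball_zero_iff.mpr ((hle _).trans_lt (mem_ball_zero_iff.mp (hm hz))))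
  have hder : deriv (fun z => l (h z)) 0 = (τ : ℂ) * l v := by
    have := l.hasFDerivAt.comp_hasDerivAt (0 : ℂ) (hh 0 hb).differentiableAt.hasDerivAt
    rw [hd, map_smul, smul_eq_mul] at this
    exact this.deriv
  rw [hder, norm_mul, Complex.norm_real, Real.norm_of_nonneg hτ.le, h0] at hS
  -- That `x` lies in the ball comes from the competing disc; without one the infimum is `⊤`.
  have hx : ‖l x‖ < 1 := (hle x).trans_lt (by rw [← h0]; exact mem_ball_zero_iff.mp (hm hb))
  have h1 := Complex.abs_re_le_norm (l v)
  have h2 := Complex.abs_re_le_norm (l x)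
  have h3 : (l x).re ^ 2 ≤ ‖l x‖ ^ 2 := sq_le_sq' (by linarith [abs_le.mp h2]) (le_of_abs_le h2)
  have h4 : 0 < 1 - ‖l x‖ ^ 2 := by nlinarith [norm_nonneg (l x)]
  rw [div_le_div_iff₀ (by linarith) hτ]
  nlinarith

/-- A curve that is `C¹` on each interval of a partition moves by no more than the integral of its
speed. -/
theorem enorm_sub_le_lintegral_of_partition {F : ℝ → ℝ} {G : ℝ → ℝ≥0∞} {p : ℕ → ℝ} {k : ℕ}
    (hp : ∀ i < k, p i < p (i + 1)) (hF : ∀ i < k, ContDiffOn ℝ 1 F (Set.Icc (p i) (p (i + 1))))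
    (hG : ∀ i < k, ∀ t ∈ Set.Ioo (p i) (p (i + 1)), ‖deriv F t‖ₑ ≤ G t) :
    p 0 ≤ p k ∧ ‖F (p k) - F (p 0)‖ₑ ≤ ∫⁻ t in Set.Ioc (p 0) (p k), G t := by
  induction k with
  | zero => simp
  | succ k ih =>
    obtain ⟨hle, ih⟩ := ih (fun i hi => hp i (by lia)) (fun i hi => hF i (by lia))
      (fun i hi => hG i (by lia))
    have hk := hp k (by lia)
    refine ⟨hle.trans hk.le, ?_⟩
    have hstep : ‖F (p (k + 1)) - F (p k)‖ₑ ≤ ∫⁻ t in Set.Ioc (p k) (p (k + 1)), G t := by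
      refine (enorm_sub_le_lintegral_deriv_of_contDiffOn_Icc (hF k (by lia)) hk.le).trans ?_
      -- End points are null, so the bound on the speed is needed only in the open interval.
      rw [← MeasureTheory.restrict_Ioo_eq_restrict_Icc, ← MeasureTheory.restrict_Ioo_eq_restrict_Ioc]
      exact MeasureTheory.setLIntegral_mono' measurableSet_Ioo (hG k (by lia))
    rw [← Set.Ioc_union_Ioc_eq_Ioc hle hk.le,
      MeasureTheory.lintegral_union measurableSet_Ioc
        (Set.Ioc_disjoint_Ioc_of_le le_rfl), ← sub_add_sub_cancel' (F (p k)) (F (p 0))]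
    exact (enorm_add_le _ _).trans (add_le_add ih hstep)

/-- The straight segment is the test curve: its metric is at most the derivative of `artanh (t *
‖w‖)`, which integrates to `artanh ‖w‖`. -/
theorem kobayashiDist_ball_zero_le {w : E} (hw : ‖w‖ < 1) :
    kobayashiDist (Metric.ball (0 : E) 1) 0 w ≤ ENNReal.ofReal (Real.artanh ‖w‖) := by
  have hball : ∀ t ∈ Set.Icc (0 : ℝ) 1, |t| * ‖w‖ < 1 := fun t ht => by
    rw [abs_of_nonneg ht.1]
    nlinarith [ht.1, ht.2, norm_nonneg w]
  have hcd : ContDiff ℝ 1 (fun t : ℝ => t • w) := contDiff_id.smul contDiff_const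
  have hderiv : ∀ t : ℝ, deriv (fun t : ℝ => t • w) t = w := fun t => by
    simpa using ((hasDerivAt_id t).smul_const w).deriv
  have hmaps : Set.MapsTo (fun t : ℝ => t • w) (Set.Icc 0 1) (Metric.ball (0 : E) 1) := by
    intro t ht
    rw [mem_ball_zero_iff, norm_smul, Real.norm_eq_abs]
    exact hball t ht
  have hpc : IsPiecewiseC1 (fun t : ℝ => t • w) := ⟨hcd.continuous.continuousOn, 1, fun i => i,
    by simp, by simp, by simp, fun _ _ => hcd.contDiffOn⟩
  have hle : kobayashiDist (Metric.ball (0 : E) 1) 0 w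
      ≤ ∫⁻ t in Set.Icc (0 : ℝ) 1, kobayashiMetric (Metric.ball (0 : E) 1) (t • w) w :=
    sInf_le ⟨fun t : ℝ => t • w, hpc, hmaps, zero_smul ℝ w, one_smul ℝ w, by simp only [hderiv]⟩
  refine hle.trans ?_
  have hIoo : ∀ t ∈ Set.Icc (0 : ℝ) 1, t * ‖w‖ ∈ Set.Ioo (-1 : ℝ) 1 := fun t ht => by
    have := abs_lt.mp (by simpa [abs_mul] using hball t ht : |t * ‖w‖| < 1)
    exact this
  have hF : ∀ t ∈ Set.Icc (0 : ℝ) 1, HasDerivAt (fun t : ℝ => Real.artanh (t * ‖w‖))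
      (‖w‖ / (1 - (t * ‖w‖) ^ 2)) t := fun t ht => by
    refine ((Real.hasDerivAt_artanh (hIoo t ht)).comp t
      ((hasDerivAt_id t).mul_const ‖w‖)).congr_deriv ?_
    ring
  have hnn : ∀ t ∈ Set.Icc (0 : ℝ) 1, 0 < 1 - (t * ‖w‖) ^ 2 := fun t ht => by
    nlinarith [(hIoo t ht).1, (hIoo t ht).2]
  have hcont : ContinuousOn (fun t : ℝ => ‖w‖ / (1 - (t * ‖w‖) ^ 2)) (Set.Icc 0 1) :=
    continuousOn_const.div (by fun_prop) fun t ht => (hnn t ht).ne'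
  have hint := intervalIntegral.integral_eq_sub_of_hasDerivAt (a := 0) (b := 1)
    (fun t ht => hF t (by simpa using ht)) (hcont.intervalIntegrable_of_Icc zero_le_one)
  rw [one_mul, zero_mul, Real.artanh_zero, sub_zero,
    intervalIntegral.integral_of_le zero_le_one, ← MeasureTheory.integral_Icc_eq_integral_Ioc]
    at hint
  rw [← hint, MeasureTheory.ofReal_integral_eq_lintegral_ofReal (hcont.integrableOn_Icc)]
  · refine MeasureTheory.setLIntegral_mono' measurableSet_Icc fun t ht => ?_
    -- The Möbius competitor normalises `w`, so `w = 0` is treated apart.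
    rcases eq_or_ne w 0 with rfl | h0
    · rw [smul_zero, kobayashiMetric_zero_right (Metric.mem_ball_self one_pos)]
      exact zero_le
    exact kobayashiMetric_ball_smul_le h0 (hball t ht)
  · filter_upwards [MeasureTheory.ae_restrict_mem measurableSet_Icc] with t ht
    exact div_nonneg (norm_nonneg w) (hnn t ht).le

/-- For a functional `l` with `‖l‖ ≤ 1` and `l w = ‖w‖`, the function `artanh (l γ).re` climbs from
`0` to `artanh ‖w‖` with speed at most the Kobayashi metric along `γ`. -/
theorem le_kobayashiDist_ball_zero (w : E) :
    ENNReal.ofReal (Real.artanh ‖w‖) ≤ kobayashiDist (Metric.ball (0 : E) 1) 0 w := by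
  refine le_sInf ?_
  rintro L ⟨γ, ⟨-, k, p, hp0, hpk, hp, hγ⟩, hm, h0, h1, rfl⟩
  -- Asking only for `‖l‖ ≤ 1` admits `w = 0`.
  obtain ⟨l, hl, hlw⟩ := exists_dual_vector'' ℂ w
  have hmono : ∀ j ≤ k, ∀ i ≤ j, p i ≤ p j := by
    intro j
    induction j with
    | zero => intro _ i hi; rw [Nat.le_zero.mp hi]
    | succ j ih =>
      intro hj i hi
      rcases Nat.lt_or_ge i (j + 1) with h | h
      · exact (ih (by lia) i (by lia)).trans (hp j (by lia)).le
      · rw [le_antisymm hi h]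
  have hsub : ∀ i < k, Set.Icc (p i) (p (i + 1)) ⊆ Set.Icc 0 1 := fun i hi =>
    Set.Icc_subset_Icc (by rw [← hp0]; exact hmono i hi.le 0 (by lia))
      (by rw [← hpk]; exact hmono k le_rfl (i + 1) hi)
  set f : ℝ → ℝ := fun t => (l (γ t)).re with hf
  set R : E →L[ℝ] ℝ := Complex.reCLM.comp (l.restrictScalars ℝ) with hR
  have hIoo : ∀ t ∈ Set.Icc (0 : ℝ) 1, f t ∈ Set.Ioo (-1 : ℝ) 1 := fun t ht => by
    have h2 : ‖l (γ t)‖ ≤ ‖γ t‖ := by simpa using l.le_of_opNorm_le hl (γ t)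
    exact abs_lt.mp ((Complex.abs_re_le_norm _).trans_lt
      (h2.trans_lt (mem_ball_zero_iff.mp (hm ht))))
  have hfc : ∀ i < k, ContDiffOn ℝ 1 f (Set.Icc (p i) (p (i + 1))) := fun i hi =>
    R.contDiff.comp_contDiffOn (hγ i hi)
  have key := (enorm_sub_le_lintegral_of_partition (F := fun t => Real.artanh (f t))
    (G := fun t => kobayashiMetric (Metric.ball (0 : E) 1) (γ t) (deriv γ t)) hp ?_ ?_).2
  · rw [hp0, hpk, MeasureTheory.restrict_Ioc_eq_restrict_Icc] at key
    have e1 : f 1 = ‖w‖ := by simp [hf, h1, hlw]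
    have e0 : f 0 = 0 := by simp [hf, h0]
    rw [e1, e0, Real.artanh_zero, sub_zero, Real.enorm_of_nonneg
      (Real.artanh_nonneg (norm_nonneg w))] at key
    exact key
  · intro i hi t ht
    exact (Real.contDiffAt_artanh (hIoo t (hsub i hi ht))).comp_contDiffWithinAt t (hfc i hi t ht)
  · intro i hi t ht
    have htI := hsub i hi (Set.Ioo_subset_Icc_self ht)
    have hγd : HasDerivAt γ (deriv γ t) t :=
      (((hγ i hi t (Set.Ioo_subset_Icc_self ht)).differentiableWithinAt one_ne_zero).differentiableAt
        (Icc_mem_nhds ht.1 ht.2)).hasDerivAt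
    have hfd : HasDerivAt f (l (deriv γ t)).re t := R.hasFDerivAt.comp_hasDerivAt t hγd
    have hpos : 0 < 1 - f t ^ 2 := by nlinarith [(hIoo t htI).1, (hIoo t htI).2]
    have := (Real.hasDerivAt_artanh (hIoo t htI)).comp t hfd
    refine le_trans (le_of_eq ?_) (le_kobayashiMetric_ball l hl)
    rw [show deriv (fun t => Real.artanh (f t)) t = _ from this.deriv, ← ofReal_norm, norm_mul,
      Real.norm_of_nonneg (by positivity), Real.norm_eq_abs]
    congr 1
    ring

/-- The Kobayashi distance from the centre of the unit ball of a complex normed space. -/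
theorem kobayashiDist_ball_zero {w : E} (hw : ‖w‖ < 1) :
    kobayashiDist (Metric.ball (0 : E) 1) 0 w = ENNReal.ofReal (Real.artanh ‖w‖) :=
  le_antisymm (kobayashiDist_ball_zero_le hw) (le_kobayashiDist_ball_zero w)

end UnitBall

/-! ## Almost geodesics of the Siegel disk -/

theorem siegelDisk_eq_ball (n : ℕ) : siegelDisk n = Metric.ball (0 : symMatrix n) 1 :=
  Set.ext fun x => by rw [mem_siegelDisk_iff, mem_ball_zero_iff]

theorem siegelFormula_zero {n : ℕ} (y : Matrix (Fin n) (Fin n) ℂ) : siegelFormula 0 y = y := by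
  simp [siegelFormula]

/-- The hypothesis is an equation because the inverse of `φ_0` is the map at `siegelNeg (siegelZero
n)`, which has to be proved equal to the zero point. -/
theorem siegelMap_of_eq_zero {n : ℕ} {x : siegelDisk n} (hx : x = siegelZero n) (y : siegelDisk n) :
    siegelMap x y = y := by
  subst hx
  exact Subtype.ext (Subtype.ext (siegelFormula_zero _))

theorem siegelSMul_eq_siegelScale {n : ℕ} (t : Set.Icc (0 : ℝ) 1) (x : siegelDisk n) :
    siegelSMul t x = siegelScale t x := by
  have h1 : siegelAut (siegelZero n) x = x := siegelMap_of_eq_zero rfl x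
  have h2 : ∀ y, (siegelAut (siegelZero n)).symm y = y :=
    siegelMap_of_eq_zero (Subtype.ext neg_zero)
  rw [siegelSMul, h1, h2]

theorem siegelAut_self {n : ℕ} (x : siegelDisk n) : siegelAut x x = siegelZero n := by
  refine Subtype.ext (Subtype.ext ?_)
  change siegelFormula (x : Matrix (Fin n) (Fin n) ℂ) x = 0
  simp [siegelFormula]

theorem kobayashiDist_siegelDisk_zero {n : ℕ} (w : siegelDisk n) :
    kobayashiDist (siegelDisk n) (siegelZero n : symMatrix n) w
      = ENNReal.ofReal (Real.artanh ‖(w : symMatrix n)‖) := by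
  have h := kobayashiDist_ball_zero ((mem_siegelDisk_iff _).mp w.2)
  rw [← siegelDisk_eq_ball] at h
  exact h

theorem norm_siegelScale {n : ℕ} (t : Set.Icc (0 : ℝ) 1) (x : siegelDisk n) :
    ‖(siegelScale t x : symMatrix n)‖ = t * ‖(x : symMatrix n)‖ := by
  change ‖((t : ℝ) : ℂ) • (x : symMatrix n)‖ = _
  rw [norm_smul, Complex.norm_real, Real.norm_of_nonneg t.2.1]

/-! ### Solving the equation for the scaling factor -/

theorem Real.tanh_mul_artanh {r : ℝ} (hr : r ∈ Set.Ioo (-1 : ℝ) 1) (t : ℝ) :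
    Real.tanh (t * Real.artanh r)
      = ((1 + r) ^ t - (1 - r) ^ t) / ((1 + r) ^ t + (1 - r) ^ t) := by
  have h1 : 0 < 1 + r := by linarith [hr.1]
  have h2 : 0 < 1 - r := by linarith [hr.2]
  rw [Real.artanh_eq_half_log ⟨hr.1.le, hr.2.le⟩, Real.log_div h1.ne' h2.ne',
    Real.rpow_def_of_pos h1, Real.rpow_def_of_pos h2, Real.tanh_eq]
  set a := Real.log (1 + r)
  set b := Real.log (1 - r)
  -- This factor, `((1 + r) * (1 - r)) ^ (t / 2)`, is common to both powers and cancels in the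
  -- quotient.
  set m := Real.exp ((a + b) / 2 * t) with hm
  have hm0 : m ≠ 0 := (Real.exp_pos _).ne'
  have ea : Real.exp (a * t) = m * Real.exp (t * (1 / 2 * (a - b))) := by
    rw [hm, ← Real.exp_add]; ring_nf
  have eb : Real.exp (b * t) = m * Real.exp (-(t * (1 / 2 * (a - b)))) := by
    rw [hm, ← Real.exp_add]; ring_nf
  rw [ea, eb, ← mul_sub, ← mul_add, mul_div_mul_left _ _ hm0]

theorem ofReal_artanh_eq_iff {r s t : ℝ} (hr : r ∈ Set.Ico (0 : ℝ) 1) (hs : s ∈ Set.Icc (0 : ℝ) 1)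
    (ht : 0 ≤ t) :
    ENNReal.ofReal (Real.artanh (s * r)) = ENNReal.ofReal t * ENNReal.ofReal (Real.artanh r) ↔
      s * r = Real.tanh (t * Real.artanh r) := by
  have hsr : s * r ∈ Set.Ico (0 : ℝ) 1 :=
    ⟨mul_nonneg hs.1 hr.1, by nlinarith [hs.1, hs.2, hr.1, hr.2]⟩
  rw [← ENNReal.ofReal_mul ht, ENNReal.ofReal_eq_ofReal_iff (Real.artanh_nonneg hsr.1)
    (mul_nonneg ht (Real.artanh_nonneg hr.1))]
  constructor
  · intro h
    rw [← h, Real.tanh_artanh ⟨by linarith [hsr.1], hsr.2⟩]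
  · intro h
    rw [h, Real.artanh_tanh]

theorem corollary6p3 (n : ℕ) (x y z : siegelDisk n) (hz : z = siegelAut x y) (r : ℝ)
    (hr : r = ‖((z : symMatrix n) : Matrix (Fin n) (Fin n) ℂ)‖) :
    ∃ c : Set.Icc (0 : ℝ) 1 → siegelDisk n,
      (∀ t : Set.Icc (0 : ℝ) 1,
        ((c t : symMatrix n) : Matrix (Fin n) (Fin n) ℂ) =
          ((1 / r * (((1 + r) ^ (t : ℝ) - (1 - r) ^ (t : ℝ)) /
            ((1 + r) ^ (t : ℝ) + (1 - r) ^ (t : ℝ))) : ℝ) : ℂ) •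
            ((z : symMatrix n) : Matrix (Fin n) (Fin n) ℂ)) ∧
      (∀ γ : Set.Icc (0 : ℝ) 1 → siegelDisk n,
        IsSiegelAlmostGeodesic x y γ ↔ ∀ t, γ t = (siegelAut x).symm (c t)) ∧
      (siegelAut x).symm (c 0) = x ∧ (siegelAut x).symm (c 1) = y := by
  have hrI : r ∈ Set.Ico (0 : ℝ) 1 := hr ▸ ⟨norm_nonneg _, siegel_norm_lt z⟩
  have hrI' : r ∈ Set.Ioo (-1 : ℝ) 1 := ⟨by linarith [hrI.1], hrI.2⟩
  have hA : 0 ≤ Real.artanh r := Real.artanh_nonneg hrI.1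
  have hrz : ‖(z : symMatrix n)‖ = r := hr.symm
  have hz0 : r = 0 → z = siegelZero n := fun h =>
    Subtype.ext (norm_eq_zero.mp (hrz.trans h))
  -- The solution of `s * r = tanh (t * artanh r)` for `s`; when `r = 0`, `1 / r = 0` makes it `0`,
  -- which is still a solution.
  set a : ℝ → ℝ := fun t => 1 / r * Real.tanh (t * Real.artanh r) with ha
  have hmono : ∀ {s t : ℝ}, s ≤ t → Real.tanh s ≤ Real.tanh t := fun h => by
    rwa [← Real.artanh_le_artanh_iff ⟨Real.neg_one_lt_tanh _, Real.tanh_lt_one _⟩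
      ⟨Real.neg_one_lt_tanh _, Real.tanh_lt_one _⟩, Real.artanh_tanh, Real.artanh_tanh]
  have haI : ∀ t ∈ Set.Icc (0 : ℝ) 1, a t ∈ Set.Icc (0 : ℝ) 1 := by
    intro t ht
    have h0 : 0 ≤ Real.tanh (t * Real.artanh r) := by
      simpa using hmono (mul_nonneg ht.1 hA)
    have h1 : Real.tanh (t * Real.artanh r) ≤ r := by
      simpa [Real.tanh_artanh hrI'] using hmono (mul_le_of_le_one_left hA ht.2)
    refine ⟨mul_nonneg (one_div_nonneg.mpr hrI.1) h0, ?_⟩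
    simp only [ha]
    rw [one_div_mul_eq_div]
    exact div_le_one_of_le₀ h1 hrI.1
  -- Uniqueness is claimed for the scaled point and not for `s`, which is undetermined when `r = 0`.
  have hscale : ∀ s t : Set.Icc (0 : ℝ) 1,
      (s : ℝ) * r = Real.tanh (t * Real.artanh r) → siegelScale s z
        = siegelScale ⟨a t, haI t t.2⟩ z := by
    intro s t h
    rcases eq_or_ne r 0 with h0 | h0
    · have hz' := hz0 h0
      refine Subtype.ext ?_
      change ((s : ℝ) : ℂ) • (z : symMatrix n) = ((a t : ℝ) : ℂ) • (z : symMatrix n)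
      have : (z : symMatrix n) = 0 := by rw [hz']; rfl
      rw [this, smul_zero, smul_zero]
    · congr 1
      refine Subtype.ext ?_
      change (s : ℝ) = 1 / r * Real.tanh (t * Real.artanh r)
      rw [← h]
      field_simp
  have har : ∀ t : ℝ, a t * r = Real.tanh (t * Real.artanh r) := by
    intro t
    simp only [ha]
    rcases eq_or_ne r 0 with h0 | h0
    · simp [h0]
    · field_simp
  have hd : ∀ s : Set.Icc (0 : ℝ) 1,
      kobayashiDist (siegelDisk n) (siegelZero n : symMatrix n) (siegelSMul s z : symMatrix n)
        = ENNReal.ofReal (Real.artanh (s * r)) := fun s => by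
    rw [kobayashiDist_siegelDisk_zero, siegelSMul_eq_siegelScale, norm_siegelScale, hrz]
  have hdz : kobayashiDist (siegelDisk n) (siegelZero n : symMatrix n) (z : symMatrix n)
      = ENNReal.ofReal (Real.artanh r) := by rw [kobayashiDist_siegelDisk_zero, hrz]
  refine ⟨fun t => siegelScale ⟨a t, haI t t.2⟩ z, ?_, ?_, ?_, ?_⟩
  · intro t
    rw [← Real.tanh_mul_artanh hrI']
    rfl
  · intro γ
    simp only [IsSiegelAlmostGeodesic, IsAlmostGeodesic, ← hz, hd, hdz]
    constructor
    · rintro ⟨α, hα, hγ⟩ t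
      rw [hγ, siegelSMul_eq_siegelScale,
        hscale _ t ((ofReal_artanh_eq_iff hrI (α t).2 t.2.1).mp (hα t))]
    · intro h
      exact ⟨fun t => ⟨a t, haI t t.2⟩,
        fun t => (ofReal_artanh_eq_iff hrI (haI t t.2) t.2.1).mpr (har t),
        fun t => by rw [h, siegelSMul_eq_siegelScale]⟩
  · rw [Equiv.symm_apply_eq, siegelAut_self]
    refine Subtype.ext ?_
    change ((a 0 : ℝ) : ℂ) • (z : symMatrix n) = 0
    simp [ha]
  · rw [Equiv.symm_apply_eq, ← hz]
    -- The factor `1` also solves the equation at `t = 1`, so uniqueness identifies the end point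
    -- with `z` even when `r = 0`, where `a 1 = 0`.
    have := hscale 1 1 (by
      change (1 : ℝ) * r = Real.tanh ((1 : ℝ) * Real.artanh r)
      rw [one_mul, one_mul, Real.tanh_artanh hrI'])
    refine this.symm.trans (Subtype.ext ?_)
    change (((1 : ℝ) : ℝ) : ℂ) • (z : symMatrix n) = z
    simp
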